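/- **Definitions.** Let $d$ be the usual distance on $[0,1]$ and $f:[0,1]\to[0,1]$ a continuous map. For $x\in[0,1]$, $n\in\mathbb N$ and $\varepsilon>0$ let $$B_n(f,x,\varepsilon)=\{y\in[0,1] : d(f^iy,f^ix)<\varepsilon \text{ for } i=0,\dots,n-1\}.$$ For $\Lambda\subset[0,1]$ and $\delta>0$ let $r_n(f,\Lambda,\delta)$ be the smallest cardinality of a set $K\subset[0,1]$ such that for every $x\in\Lambda$ there is $y\in K$ with $d(f^ix,f^iy)<\delta$ for $i=0,\dots,n-1$. The $\varepsilon$-tail entropy of $f$ is $$h^*(f,\varepsilon)=\lim_{\delta\to0}\ \limsup_{n\to\infty}\ \frac1n\log\ \sup_{x\in[0,1]} r_n\bigl(f,B_n(f,x,\varepsilon),\delta\bigr).$$ The continuous map $f$ is called $l$-multimodal if $l$ is the least number of intervals in a subdivision of $[0,1]$ into finitely many intervals on each of which $f$ is monotone. For an integer $r\ge 1$ and a $C^r$ map $f$ put $\|f\|_r=\max_{k=1,\dots,r}\ \sup_{x\in[0,1]}|f^{(k)}(x)|$. Finally $\log^+t=\max(\log t,0)$ for $t>0$, and $\log^+0=0$.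 **Theorem.** Let $f:[0,1]\to[0,1]$ be an $l$-multimodal map of class $C^l$. Then for every $0<\varepsilon<1$, $$h^*(f,\varepsilon)\le\frac{\log^+\|f\|_{l}}{|\log\varepsilon|}.$$ -/

import Mathlib

open Filter Topology

noncomputable section

namespace TailEntropy

variable {X : Type*} [PseudoMetricSpace X]

/-- The `n`-step dynamical ball `B_n(T, x, ε)`: the points `y` with
`d(T^i y, T^i x) < ε` for `i = 0, …, n - 1`. -/
def dynBall (T : X → X) (n : ℕ) (x : X) (ε : ℝ) : Set X :=
  {y | ∀ i < n, dist (T^[i] y) (T^[i] x) < ε}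

/-- `r_n(T, Λ, δ)`: the smallest cardinality of a finite set `K ⊆ X` such that every `x ∈ Λ` has
some `y ∈ K` with `d(T^i x, T^i y) < δ` for `i = 0, …, n - 1` (and `∞` if there is no such `K`). -/
def spanningCard (T : X → X) (n : ℕ) (Λ : Set X) (δ : ℝ) : ℕ∞ :=
  Dynamics.coverMincard T Λ {p : X × X | dist p.1 p.2 < δ} n

/-- `limsup_n (1/n) log sup_x r_n(T, B_n(T, x, ε), δ)`. -/
def tailEntropyAt (T : X → X) (ε δ : ℝ) : EReal :=
  limsup (fun n : ℕ => ENNReal.log ((⨆ x : X, spanningCard T n (dynBall T n x ε) δ : ℕ∞)) / n)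
    atTop

/-- The `ε`-tail entropy
`h^*(T, ε) = lim_{δ → 0} limsup_n (1/n) log sup_x r_n(T, B_n(T, x, ε), δ)`.
The quantity is antitone in `δ`, so that the limit is the supremum over `δ > 0`
(see `tendsto_tailEntropyAt`). -/
def tailEntropy (T : X → X) (ε : ℝ) : EReal :=
  ⨆ δ : Set.Ioi (0 : ℝ), tailEntropyAt T ε δ

theorem tailEntropyAt_antitone (T : X → X) (ε : ℝ) : Antitone (tailEntropyAt T ε) := by
  intro δ δ' h
  refine limsup_le_limsup (Eventually.of_forall fun n => ?_)
  refine EReal.div_le_div_right_of_nonneg (by positivity) (ENNReal.log_monotone ?_)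
  refine ENat.toENNReal_mono (iSup_mono fun x => ?_)
  exact Dynamics.coverMincard_antitone T _ n fun p hp => lt_of_lt_of_le hp h

theorem tendsto_tailEntropyAt (T : X → X) (ε : ℝ) :
    Tendsto (tailEntropyAt T ε) (𝓝[>] 0) (𝓝 (tailEntropy T ε)) := by
  have h := (tailEntropyAt_antitone T ε).tendsto_nhdsGT 0
  rwa [sSup_image'] at h

end TailEntropy

namespace IntervalMap

/-- `[0,1]` is the union of `k` consecutive nondegenerate closed intervals, with endpoints
`0 = c 0 < c 1 < ⋯ < c k = 1`, on each of which `f` is monotone. -/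
def IsMonotoneSubdivision (f : unitInterval → unitInterval) (k : ℕ)
    (c : Fin (k + 1) → unitInterval) : Prop :=
  StrictMono c ∧ c 0 = 0 ∧ c (Fin.last k) = 1 ∧
    ∀ i : Fin k, MonotoneOn f (Set.Icc (c i.castSucc) (c i.succ)) ∨
      AntitoneOn f (Set.Icc (c i.castSucc) (c i.succ))

/-- `f` is `l`-multimodal: it is continuous, and `l` is the number of intervals in a minimal
subdivision of `[0,1]` into intervals of monotonicity of `f`. -/
def IsMultimodal (l : ℕ) (f : unitInterval → unitInterval) : Prop :=
  Continuous f ∧ IsLeast {k : ℕ | ∃ c, IsMonotoneSubdivision f k c} l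

/-- `f` as a real function on `ℝ`, extended by constants outside `[0,1]`; only its values on
`[0,1]` are used below. -/
def toReal (f : unitInterval → unitInterval) : ℝ → ℝ :=
  Set.IccExtend zero_le_one fun x => (f x : ℝ)

/-- `f` is of class `C^r` on `[0,1]` (with one-sided derivatives at the endpoints). -/
def IsCr (r : ℕ) (f : unitInterval → unitInterval) : Prop :=
  ContDiffOn ℝ r (toReal f) unitInterval

/-- The supremum norm `‖f^{(k)}‖` over `[0,1]` of the `k`-th derivative. -/
def derivSupNorm (k : ℕ) (f : unitInterval → unitInterval) : ℝ :=
  ⨆ x : unitInterval, |iteratedDerivWithin k (toReal f) unitInterval x|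

/-- `‖f‖_r = max_{k = 1, …, r} ‖f^{(k)}‖`, for `r ≥ 1`. -/
def crNorm (r : ℕ) (f : unitInterval → unitInterval) : ℝ :=
  ⨆ k : Finset.Icc 1 r, derivSupNorm k f

end IntervalMap

end

/-! Put s = 1/|log ε|, so that ε^s = 1/e, and M = ‖f‖_l, A = max(1, M). If s ≥ 1, it suffices that
an A-Lipschitz map has entropy at most log A. Let s ≤ 1.

The heart is a local estimate, `IsCr.hasLocalExpansion`. Minimality of the subdivision forces f' to
vanish at its interior endpoints. If an ε-ball contains k of them, then k + 1 ≤ l and the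
interpolation remainder for f' gives |f'| ≤ M (2ε)^k / k! on the ball. At most k + 1 laps meet the
ball, and ε^(sk) = e^(-k) outweighs this number: the s-th powers of the Lipschitz constants on these
laps add up to at most A^s (for k = 1 a finer bound on each side of the turning point is needed).

This is iterated along orbits in `hasCover_inter_dynBall`. Sets of diameter bound at least η are cut
into laps, which costs a factor A^s per step, weighted by the s-th power of the diameter. Shorter
sets are cut at most in two, and only near a turning point, where f contracts by an arbitrarily
small τ; the doubling is paid for by a factor A^(κn) with κ arbitrarily small. On each final piece
every iterate is monotone or has a small image, so linearly many points span it. The growth rate is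
at most (s + κ) log A, and κ tends to 0. -/

open Filter Topology

noncomputable section

namespace IntervalMap

open scoped unitInterval

/-! ### Covers by admissible sets and spanning numbers -/

section

/-- Each iterate `f^i`, `i < n`, is monotone or antitone on `Y`, or maps `Y` to a set of diameter
less than `δ`. -/
def IsAdmissible (f : I → I) (δ : ℝ) (n : ℕ) (Y : Set I) : Prop :=
  ∀ i < n, MonotoneOn f^[i] Y ∨ AntitoneOn f^[i] Y ∨
    ∀ y ∈ Y, ∀ z ∈ Y, dist (f^[i] y) (f^[i] z) < δ

/-- `A` is covered by at most `b` sets that are admissible up to time `n`. -/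
def HasCover (f : I → I) (δ : ℝ) (n : ℕ) (A : Set I) (b : ℝ) : Prop :=
  ∃ C : Finset (Set I), (C.card : ℝ) ≤ b ∧ A ⊆ ⋃ Y ∈ C, Y ∧ ∀ Y ∈ C, IsAdmissible f δ n Y

variable {f : I → I} {δ ε : ℝ} {n : ℕ}

/-- The index of the cell of length `δ` that contains `t`. -/
def cell (δ : ℝ) (t : I) : ℕ := ⌊(t : ℝ) / δ⌋₊

theorem cell_mono (hδ : 0 < δ) : Monotone (cell δ) := fun _ _ h =>
  Nat.floor_mono (div_le_div_of_nonneg_right h hδ.le)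

theorem cell_le (hδ : 0 < δ) (t : I) : cell δ t ≤ ⌊1 / δ⌋₊ :=
  Nat.floor_mono (div_le_div_of_nonneg_right t.2.2 hδ.le)

theorem dist_lt_of_cell_eq (hδ : 0 < δ) {a b : I} (h : cell δ a = cell δ b) : dist a b < δ := by
  have ha := Nat.floor_le (div_nonneg a.2.1 hδ.le)
  have hb := Nat.floor_le (div_nonneg b.2.1 hδ.le)
  have ha' := Nat.lt_floor_add_one ((a : ℝ) / δ)
  have hb' := Nat.lt_floor_add_one ((b : ℝ) / δ)
  unfold cell at h
  rw [h] at ha ha'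
  have : |(a : ℝ) / δ - b / δ| < 1 := by rw [abs_lt]; constructor <;> linarith
  rw [← sub_div, abs_div, abs_of_pos hδ, div_lt_one hδ] at this
  rwa [Subtype.dist_eq, Real.dist_eq]

/-- Monotone reparametrizations of the cell indices along an orbit in an admissible set. -/
theorem IsAdmissible.exists_monotone (hδ : 0 < δ) {Y : Set I} (hY : IsAdmissible f δ n Y) :
    ∃ w : ℕ → I → ℕ, (∀ i y, w i y ≤ ⌊1 / δ⌋₊) ∧ (∀ i < n, MonotoneOn (w i) Y) ∧
      ∀ i < n, ∀ y ∈ Y, ∀ z ∈ Y, w i y = w i z → dist (f^[i] y) (f^[i] z) < δ := by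
  have key : ∀ i, ∃ w : I → ℕ, (∀ y, w y ≤ ⌊1 / δ⌋₊) ∧ (i < n → MonotoneOn w Y ∧
      ∀ y ∈ Y, ∀ z ∈ Y, w y = w z → dist (f^[i] y) (f^[i] z) < δ) := by
    intro i
    by_cases hi : i < n
    · rcases hY i hi with h | h | h
      · exact ⟨fun y => cell δ (f^[i] y), fun y => cell_le hδ _, fun _ =>
          ⟨fun _ ha _ hb hab => cell_mono hδ (h ha hb hab),
            fun y _ z _ e => dist_lt_of_cell_eq hδ e⟩⟩
      · refine ⟨fun y => ⌊1 / δ⌋₊ - cell δ (f^[i] y), fun y => Nat.sub_le _ _, fun _ =>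
          ⟨fun a ha b hb hab => Nat.sub_le_sub_left (cell_mono hδ (h ha hb hab)) _,
            fun y _ z _ e => dist_lt_of_cell_eq hδ ?_⟩⟩
        -- Both cell indices are at most `⌊1 / δ⌋₊`, so the truncated subtraction is injective on
        -- them.
        have h1 := cell_le hδ (f^[i] y)
        have h2 := cell_le hδ (f^[i] z)
        dsimp only at e
        omega
      · exact ⟨fun _ => 0, fun _ => Nat.zero_le _, fun _ =>
          ⟨fun _ _ _ _ _ => le_rfl, fun y hy z hz _ => h y hy z hz⟩⟩
    · exact ⟨fun _ => 0, fun _ => Nat.zero_le _, fun h => absurd h hi⟩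
  choose w h1 h2 using key
  exact ⟨w, h1, fun i hi => (h2 i hi).1, fun i hi => (h2 i hi).2⟩

/-- The sum over time of the monotone indices is monotone on `Y` and takes at most n⌊1/δ⌋ + 1
values. Two ordered points with equal sums have equal indices at every time, so one representative
per value suffices. -/
theorem IsAdmissible.exists_dynCover (hδ : 0 < δ) {Y : Set I} (hY : IsAdmissible f δ n Y) :
    ∃ K : Finset I, K.card ≤ n * ⌊1 / δ⌋₊ + 1 ∧
      Dynamics.IsDynCoverOf f Y {p : I × I | dist p.1 p.2 < δ} n K := by
  classical
  obtain ⟨w, hw1, hw2, hw3⟩ := hY.exists_monotone hδ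
  set S : I → ℕ := fun y => ∑ i ∈ Finset.range n, w i y with hS
  have hSle : ∀ y, S y ≤ n * ⌊1 / δ⌋₊ := fun y => by
    simpa using Finset.sum_le_card_nsmul (Finset.range n) (fun i => w i y) _ fun i _ => hw1 i y
  have hclose : ∀ y ∈ Y, ∀ z ∈ Y, y ≤ z → S y = S z →
      ∀ i < n, dist (f^[i] y) (f^[i] z) < δ := by
    intro y hy z hz hyz e i hi
    refine hw3 i hi y hy z hz ?_
    exact (Finset.sum_eq_sum_iff_of_le fun i hi =>
      hw2 i (Finset.mem_range.1 hi) hy hz hyz).1 e i (Finset.mem_range.2 hi)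
  -- The default `0` is harmless: `r` matters only at values attained by `S` on `Y`.
  let r : ℕ → I := fun v => if h : ∃ y ∈ Y, S y = v then h.choose else 0
  refine ⟨(Finset.range (n * ⌊1 / δ⌋₊ + 1)).image r,
    Finset.card_image_le.trans (by simp), fun y hy => ?_⟩
  have h : ∃ z ∈ Y, S z = S y := ⟨y, hy, rfl⟩
  have hr : r (S y) = h.choose := dif_pos h
  refine ⟨r (S y), ?_, ?_⟩
  · exact Finset.mem_coe.2 (Finset.mem_image_of_mem _
      (Finset.mem_range.2 (Nat.lt_succ_of_le (hSle y))))
  · rw [Dynamics.mem_dynEntourage, hr]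
    intro i hi
    have hz := h.choose_spec
    rcases le_total y h.choose with hle | hle
    · exact hclose y hy _ hz.1 hle hz.2.symm i hi
    · have := hclose _ hz.1 y hy hle hz.2 i hi
      rwa [dist_comm] at this

theorem HasCover.spanningCard_le (hδ : 0 < δ) {A : Set I} {b : ℝ} (h : HasCover f δ n A b) :
    TailEntropy.spanningCard f n A δ ≤ (⌊b * (n * ⌊1 / δ⌋₊ + 1)⌋₊ : ℕ) := by
  classical
  obtain ⟨C, hb, hA, hC⟩ := h
  choose! K hK1 hK2 using fun Y hY => (hC Y hY).exists_dynCover hδ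
  have hcov : Dynamics.IsDynCoverOf f A {p : I × I | dist p.1 p.2 < δ} n
      ((C.biUnion K : Finset I) : Set I) := by
    intro y hy
    obtain ⟨Y, hY, hyY⟩ := Set.mem_iUnion₂.1 (hA hy)
    obtain ⟨z, hz, hyz⟩ := hK2 Y hY hyY
    exact ⟨z, Finset.mem_coe.2 (Finset.mem_biUnion.2 ⟨Y, hY, Finset.mem_coe.1 hz⟩), hyz⟩
  refine hcov.coverMincard_le_card.trans ?_
  refine Nat.cast_le.2 (Nat.le_floor ?_)
  have h1 : (C.biUnion K).card ≤ C.card * (n * ⌊1 / δ⌋₊ + 1) :=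
    Finset.card_biUnion_le_card_mul _ _ _ hK1
  calc ((C.biUnion K).card : ℝ) ≤ C.card * (n * ⌊1 / δ⌋₊ + 1) := by exact_mod_cast h1
    _ ≤ _ := by gcongr

theorem tendsto_log_polynomial_mul_pow_div {C q : ℝ} (hC : 0 < C) (hq : 0 < q) :
    Tendsto (fun n : ℕ => Real.log (C * (n + 1) ^ 2 * q ^ n) / n) atTop (𝓝 (Real.log q)) := by
  have h1 : Tendsto (fun n : ℕ => Real.log C / n) atTop (𝓝 0) :=
    tendsto_const_div_atTop_nhds_zero_nat _
  have h2 : Tendsto (fun n : ℕ => Real.log ((n : ℝ) + 1) / n) atTop (𝓝 0) := by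
    have h := (Real.isLittleO_log_id_atTop.tendsto_div_nhds_zero).comp
      (tendsto_atTop_add_const_right atTop (1 : ℝ) tendsto_natCast_atTop_atTop)
    have h' : Tendsto (fun n : ℕ => ((n : ℝ) + 1) / n) atTop (𝓝 1) := by
      have := (tendsto_const_nhds (x := (1 : ℝ)) (f := atTop)).add
        (tendsto_const_div_atTop_nhds_zero_nat (1 : ℝ))
      rw [add_zero] at this
      refine this.congr' ?_
      filter_upwards [eventually_gt_atTop 0] with n hn
      have : (n : ℝ) ≠ 0 := by positivity
      field_simp
    have := h.mul h'
    rw [zero_mul] at this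
    refine this.congr fun n => ?_
    have : (n : ℝ) + 1 ≠ 0 := by positivity
    simp only [Function.comp, id]
    field_simp
  have h3 := (h1.add (h2.const_mul 2)).add (tendsto_const_nhds (x := Real.log q))
  rw [mul_zero, add_zero, zero_add] at h3
  refine h3.congr' ?_
  filter_upwards [eventually_gt_atTop 0] with n hn
  have hn' : (n : ℝ) ≠ 0 := by positivity
  rw [Real.log_mul (by positivity) (by positivity), Real.log_mul (by positivity) (by positivity),
    Real.log_pow, Real.log_pow]
  field_simp
  push_cast
  ring

/-- Each admissible set costs a number of points linear in `n`; the resulting factor (n + 1)^2 does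
not affect the exponential growth rate. -/
theorem tailEntropyAt_le_of_hasCover (hδ : 0 < δ) {C q : ℝ} (hC : 0 < C) (hq : 0 < q)
    (h : ∀ n x, HasCover f δ n (TailEntropy.dynBall f n x ε) (C * (n + 1) * q ^ n)) :
    TailEntropy.tailEntropyAt f ε δ ≤ (Real.log q : ℝ) := by
  set g : ℕ := ⌊1 / δ⌋₊
  have hC' : 0 < C * (g + 1) := by positivity
  have hlim := (continuous_coe_real_ereal.tendsto _).comp
    (tendsto_log_polynomial_mul_pow_div hC' hq)
  rw [← hlim.limsup_eq]
  refine limsup_le_limsup (Eventually.of_forall fun n => ?_)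
  have hpos : 0 < C * (g + 1) * (n + 1) ^ 2 * q ^ n := by positivity
  have hle : (⨆ x : I, TailEntropy.spanningCard f n (TailEntropy.dynBall f n x ε) δ) ≤
      ((⌊C * (g + 1) * (n + 1) ^ 2 * q ^ n⌋₊ : ℕ) : ℕ∞) := by
    refine iSup_le fun x => ((h n x).spanningCard_le hδ).trans ?_
    refine Nat.cast_le.2 (Nat.floor_mono ?_)
    have hn : (0 : ℝ) ≤ n := n.cast_nonneg
    have hg : (0 : ℝ) ≤ g := g.cast_nonneg
    have : (n : ℝ) * g + 1 ≤ (g + 1) * (n + 1) := by nlinarith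
    calc C * (n + 1) * q ^ n * (n * g + 1) ≤ C * (n + 1) * q ^ n * ((g + 1) * (n + 1)) := by
          gcongr
      _ = _ := by ring
  have h2 : ((⨆ x : I, TailEntropy.spanningCard f n (TailEntropy.dynBall f n x ε) δ : ℕ∞) :
      ENNReal) ≤ ENNReal.ofReal (C * (g + 1) * (n + 1) ^ 2 * q ^ n) := by
    refine (ENat.toENNReal_mono hle).trans ?_
    rw [ENat.toENNReal_coe]
    rw [← ENNReal.ofReal_natCast]
    exact ENNReal.ofReal_le_ofReal (Nat.floor_le hpos.le)
  have h3 := ENNReal.log_monotone h2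
  rw [ENNReal.log_ofReal_of_pos hpos] at h3
  refine (EReal.div_le_div_right_of_nonneg (by positivity) h3).trans (le_of_eq ?_)
  simp [Function.comp, EReal.coe_div]

theorem HasCover.mono {A B : Set I} {b c : ℝ} (h : HasCover f δ n A b) (hBA : B ⊆ A)
    (hbc : b ≤ c) : HasCover f δ n B c := by
  obtain ⟨C, h1, h2, h3⟩ := h
  exact ⟨C, h1.trans hbc, hBA.trans h2, h3⟩

theorem IsAdmissible.hasCover {Y : Set I} (h : IsAdmissible f δ n Y) : HasCover f δ n Y 1 :=
  ⟨{Y}, by simp, by simp, by simpa using h⟩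

theorem HasCover.biUnion {ι : Type*} {T : Finset ι} {A : ι → Set I} {b : ι → ℝ}
    (h : ∀ j ∈ T, HasCover f δ n (A j) (b j)) :
    HasCover f δ n (⋃ j ∈ T, A j) (∑ j ∈ T, b j) := by
  classical
  choose! C h1 h2 h3 using h
  refine ⟨T.biUnion C, ?_, ?_, ?_⟩
  · calc ((T.biUnion C).card : ℝ) ≤ ((∑ j ∈ T, (C j).card : ℕ) : ℝ) := by
          exact_mod_cast Finset.card_biUnion_le
      _ = ∑ j ∈ T, ((C j).card : ℝ) := by push_cast; rfl
      _ ≤ _ := Finset.sum_le_sum h1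
  · intro y hy
    obtain ⟨j, hj, hyj⟩ := Set.mem_iUnion₂.1 hy
    obtain ⟨Y, hY, hyY⟩ := Set.mem_iUnion₂.1 (h2 j hj hyj)
    exact Set.mem_iUnion₂.2 ⟨Y, Finset.mem_biUnion.2 ⟨j, hj, hY⟩, hyY⟩
  · intro Y hY
    obtain ⟨j, hj, hYj⟩ := Finset.mem_biUnion.1 hY
    exact h3 j hj Y hYj

/-- Composing with a map that is monotone on `B` preserves admissibility, so a cover of the image
pulls back without any increase in number. -/
theorem HasCover.preimage {B D : Set I} {b : ℝ} (hf : MonotoneOn f B ∨ AntitoneOn f B)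
    (h : HasCover f δ n (f '' B ∩ D) b) : HasCover f δ (n + 1) (B ∩ f ⁻¹' D) b := by
  classical
  obtain ⟨C, h1, h2, h3⟩ := h
  refine ⟨C.image fun Y => B ∩ f ⁻¹' Y, ?_, ?_, ?_⟩
  · exact (Nat.cast_le.2 Finset.card_image_le).trans h1
  · rintro y ⟨hyB, hyD⟩
    obtain ⟨Y, hY, hyY⟩ := Set.mem_iUnion₂.1 (h2 ⟨Set.mem_image_of_mem f hyB, hyD⟩)
    exact Set.mem_iUnion₂.2 ⟨_, Finset.mem_image_of_mem _ hY, hyB, hyY⟩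
  · intro Z hZ
    obtain ⟨Y, hY, rfl⟩ := Finset.mem_image.1 hZ
    intro i hi
    rcases i with _ | i
    · exact Or.inl fun a _ b _ hab => hab
    · rw [Function.iterate_succ]
      rcases h3 Y hY i (by omega) with g | g | g
      · rcases hf with hf | hf
        · exact Or.inl fun a ha b hb hab => g ha.2 hb.2 (hf ha.1 hb.1 hab)
        · exact Or.inr (Or.inl fun a ha b hb hab => g hb.2 ha.2 (hf ha.1 hb.1 hab))
      · rcases hf with hf | hf
        · exact Or.inr (Or.inl fun a ha b hb hab => g ha.2 hb.2 (hf ha.1 hb.1 hab))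
        · exact Or.inl fun a ha b hb hab => g hb.2 ha.2 (hf ha.1 hb.1 hab)
      · exact Or.inr (Or.inr fun y hy z hz => g _ hy.2 _ hz.2)

theorem dist_iterate_le {A : ℝ} (hA : 0 ≤ A) (hf : ∀ y z, dist (f y) (f z) ≤ A * dist y z)
    (i : ℕ) (y z : I) : dist (f^[i] y) (f^[i] z) ≤ A ^ i * dist y z := by
  induction i generalizing y z with
  | zero => simp
  | succ i ih =>
    rw [Function.iterate_succ_apply, Function.iterate_succ_apply, pow_succ, mul_assoc]
    exact (ih _ _).trans (mul_le_mul_of_nonneg_left (hf y z) (by positivity))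

theorem isAdmissible_of_dist_le {A L : ℝ} (hA : 1 ≤ A)
    (hf : ∀ y z, dist (f y) (f z) ≤ A * dist y z) {S : Set I}
    (hS : ∀ y ∈ S, ∀ z ∈ S, dist y z ≤ L) (hL : A ^ n * L < δ) : IsAdmissible f δ n S := by
  intro i hi
  refine Or.inr (Or.inr fun y hy z hz => ?_)
  refine (dist_iterate_le (by positivity) hf i y z).trans_lt (lt_of_le_of_lt ?_ hL)
  exact mul_le_mul (pow_le_pow_right₀ hA hi.le) (hS y hy z hz) dist_nonneg (by positivity)

/-- The topological entropy of a map with Lipschitz constant `A` is at most `log A`. -/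
theorem tailEntropyAt_le_log_lipschitz {A : ℝ} (hA : 1 ≤ A)
    (hf : ∀ y z, dist (f y) (f z) ≤ A * dist y z) (hδ : 0 < δ) :
    TailEntropy.tailEntropyAt f ε δ ≤ (Real.log A : ℝ) := by
  have hA0 : 0 < A := by linarith
  refine tailEntropyAt_le_of_hasCover hδ (C := 2 / δ + 1) (by positivity) hA0 fun n x => ?_
  -- At this scale `n` steps expand a cell to length at most δ/2 < δ.
  set ρ : ℝ := δ / (2 * A ^ n) with hρ
  have hρ0 : 0 < ρ := by positivity
  have hadm : ∀ k ∈ Finset.range (⌊1 / ρ⌋₊ + 1), HasCover f δ n {y : I | cell ρ y = k} 1 := by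
    intro k _
    refine IsAdmissible.hasCover (isAdmissible_of_dist_le (L := ρ) hA hf ?_ ?_)
    · intro y hy z hz
      exact (dist_lt_of_cell_eq hρ0 (hy.trans hz.symm)).le
    · have : A ^ n * ρ = δ / 2 := by rw [hρ]; field_simp
      rw [this]; linarith
  refine (HasCover.biUnion hadm).mono ?_ ?_
  · intro y _
    exact Set.mem_iUnion₂.2 ⟨cell ρ y, Finset.mem_range.2 (Nat.lt_succ_of_le (cell_le hρ0 y)), rfl⟩
  · rw [Finset.sum_const, Finset.card_range, nsmul_eq_mul, mul_one]
    push_cast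
    have h1 : (⌊1 / ρ⌋₊ : ℝ) ≤ 1 / ρ := Nat.floor_le (by positivity)
    have h2 : 1 / ρ = 2 / δ * A ^ n := by rw [hρ]; field_simp
    have h3 : (1 : ℝ) ≤ A ^ n := one_le_pow₀ hA
    have h4 : (2 / δ + 1) * A ^ n ≤ (2 / δ + 1) * (n + 1) * A ^ n := by
      have : (1 : ℝ) ≤ n + 1 := by linarith [n.cast_nonneg (α := ℝ)]
      nlinarith [mul_le_mul_of_nonneg_left this (by positivity : 0 ≤ (2 / δ + 1) * A ^ n)]
    nlinarith

end

/-! ### Counting pieces along orbits -/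

section

variable {f : I → I} {δ ε : ℝ} {n : ℕ}

theorem dynBall_succ (x : I) : TailEntropy.dynBall f (n + 1) x ε =
    Metric.ball x ε ∩ f ⁻¹' TailEntropy.dynBall f n (f x) ε := by
  ext y
  simp only [TailEntropy.dynBall, Set.mem_ofPred_eq, Set.mem_inter_iff, Metric.mem_ball,
    Set.mem_preimage]
  constructor
  · exact fun h => ⟨h 0 (Nat.succ_pos n), fun i hi => h (i + 1) (Nat.succ_lt_succ hi)⟩
  · rintro ⟨h0, h⟩ i hi
    rcases i with _ | i
    · exact h0
    · exact h i (Nat.lt_of_succ_lt_succ hi)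

/-- A bound for the number of admissible pieces, up to time `n`, of a set of diameter `L`. -/
def pieceBound (l : ℕ) (A s κ δ η : ℝ) (n : ℕ) (L : ℝ) : ℝ :=
  max 1 (2 * (L * A ^ n / δ) ^ κ) * (1 + n * l * (A ^ s) ^ n * (L / η) ^ s)

/-- The local expansion on the pieces of a family of sets of monotonicity: for each ball, the
`s`-th powers of the Lipschitz constants on the pieces that meet the ball add up to at most `G`. -/
def HasLocalExpansion {ι : Type*} (f : I → I) (J : ι → Set I) (l : ℕ) (s ε G : ℝ) : Prop :=
  ∀ x : I, ∃ (T : Finset ι) (a : ι → ℝ), T.card ≤ l ∧ (∀ j, 0 ≤ a j) ∧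
    (Metric.ball x ε ⊆ ⋃ j ∈ T, J j) ∧
    (∀ j ∈ T, ∀ y ∈ J j ∩ Metric.ball x ε, ∀ z ∈ J j ∩ Metric.ball x ε,
      dist (f y) (f z) ≤ a j * dist y z) ∧
    ∑ j ∈ T, a j ^ s ≤ G

/-- Sets of diameter less than `η` lie in one set of monotonicity, or in two of them, and in the
latter case `f` has Lipschitz constant `τ` on them. -/
def HasSmallFolds {ι : Type*} (f : I → I) (J : ι → Set I) (η τ : ℝ) : Prop :=
  ∀ S : Set I, (∀ y ∈ S, ∀ z ∈ S, dist y z < η) → (∃ j, S ⊆ J j) ∨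
    ∃ i j, S ⊆ J i ∪ J j ∧ ∀ y ∈ S, ∀ z ∈ S, dist (f y) (f z) ≤ τ * dist y z

section pieceBound

variable {l : ℕ} {A s κ η L : ℝ}

theorem one_le_pieceBound (hA : 0 ≤ A) (hη : 0 ≤ η) (hL : 0 ≤ L) :
    1 ≤ pieceBound l A s κ δ η n L := by
  unfold pieceBound
  have h1 : (1 : ℝ) ≤ max 1 (2 * (L * A ^ n / δ) ^ κ) := le_max_left _ _
  have h2 : 0 ≤ (n : ℝ) * l * (A ^ s) ^ n * (L / η) ^ s := by positivity
  nlinarith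

/-- The first factor only uses `b ≤ A`; the contraction `b ≤ a` is kept for the second factor, where
the `a ^ s` will be summed. -/
theorem pieceBound_mul_le (hA : 0 ≤ A) (hη : 0 < η) (hδ : 0 < δ) (hκ : 0 ≤ κ) (hL : 0 ≤ L)
    {a b : ℝ} (hb0 : 0 ≤ b) (hba : b ≤ a) (hbA : b ≤ A) (hs : 0 ≤ s) :
    pieceBound l A s κ δ η n (b * L) ≤ max 1 (2 * (L * A ^ (n + 1) / δ) ^ κ) *
      (1 + n * l * (A ^ s) ^ n * (a ^ s * (L / η) ^ s)) := by
  unfold pieceBound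
  have h1 : b * L * A ^ n / δ ≤ L * A ^ (n + 1) / δ := by
    rw [pow_succ]
    gcongr ?_ / δ
    calc b * L * A ^ n ≤ A * L * A ^ n := by gcongr
      _ = _ := by ring
  have h2 : (b * L / η) ^ s ≤ a ^ s * (L / η) ^ s := by
    rw [mul_div_assoc, Real.mul_rpow hb0 (by positivity)]
    gcongr
  gcongr

/-- The step for long sets, that are cut into their pieces. -/
theorem sum_pieceBound_le {ι : Type*} {T : Finset ι} {a : ι → ℝ} (hA : 1 ≤ A) (hη : 0 < η)
    (hδ : 0 < δ) (hκ : 0 ≤ κ) (hs : 0 ≤ s) (hL : η ≤ L) (hT : T.card ≤ l) (ha : ∀ j, 0 ≤ a j)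
    (hsum : ∑ j ∈ T, a j ^ s ≤ A ^ s) :
    ∑ j ∈ T, pieceBound l A s κ δ η n (min (a j) A * L) ≤ pieceBound l A s κ δ η (n + 1) L := by
  have hL0 : 0 ≤ L := hη.le.trans hL
  have hA0 : 0 ≤ A := by linarith
  set W := max 1 (2 * (L * A ^ (n + 1) / δ) ^ κ) with hW
  set R := (L / η) ^ s with hR
  have hR1 : 1 ≤ R := Real.one_le_rpow ((one_le_div hη).2 hL) hs
  have hG1 : 1 ≤ (A ^ s) ^ (n + 1) := one_le_pow₀ (Real.one_le_rpow hA hs)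
  have hW0 : 0 ≤ W := zero_le_one.trans (le_max_left _ _)
  have hT' : (T.card : ℝ) ≤ l := by exact_mod_cast hT
  have hl0 : (0 : ℝ) ≤ l := Nat.cast_nonneg l
  calc ∑ j ∈ T, pieceBound l A s κ δ η n (min (a j) A * L)
      ≤ ∑ j ∈ T, W * (1 + n * l * (A ^ s) ^ n * (a j ^ s * R)) :=
        Finset.sum_le_sum fun j _ => pieceBound_mul_le hA0 hη hδ hκ hL0
          (le_min (ha j) hA0) (min_le_left _ _) (min_le_right _ _) hs
    _ = W * (T.card + n * l * (A ^ s) ^ n * ((∑ j ∈ T, a j ^ s) * R)) := by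
        rw [← Finset.mul_sum, Finset.sum_add_distrib, ← Finset.mul_sum, ← Finset.sum_mul]
        simp
    _ ≤ W * (l + n * l * (A ^ s) ^ n * (A ^ s * R)) := by gcongr
    _ ≤ W * (1 + (n + 1 : ℕ) * l * (A ^ s) ^ (n + 1) * R) := by
        -- The summand 1 of each of the at most `l` pieces is absorbed when the coefficient n grows
        -- to n + 1, because `R ≥ 1` for long sets.
        have h1 : (l : ℝ) * 1 ≤ l * ((A ^ s) ^ (n + 1) * R) :=
          mul_le_mul_of_nonneg_left (one_le_mul_of_one_le_of_one_le hG1 hR1) hl0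
        refine mul_le_mul_of_nonneg_left ?_ hW0
        have h2 : (n : ℝ) * l * (A ^ s) ^ n * (A ^ s * R) = n * l * (A ^ s) ^ (n + 1) * R := by
          ring
        rw [h2]
        push_cast
        linarith

/-- The step for short sets that lie in a single piece. -/
theorem pieceBound_lipschitz_le (hA : 1 ≤ A) (hη : 0 < η) (hδ : 0 < δ) (hκ : 0 ≤ κ) (hs : 0 ≤ s)
    (hL : 0 ≤ L) : pieceBound l A s κ δ η n (A * L) ≤ pieceBound l A s κ δ η (n + 1) L := by
  have hA0 : 0 ≤ A := by linarith
  refine (pieceBound_mul_le hA0 hη hδ hκ hL hA0 le_rfl le_rfl hs).trans ?_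
  unfold pieceBound
  gcongr ?_ * (1 + ?_)
  calc (n : ℝ) * l * (A ^ s) ^ n * (A ^ s * (L / η) ^ s)
      = n * l * (A ^ s) ^ (n + 1) * (L / η) ^ s := by ring
    _ ≤ _ := by gcongr; simp

/-- The step for short sets that are folded. -/
theorem two_mul_pieceBound_le {τ : ℝ} (hA : 1 ≤ A) (hη : 0 < η) (hδ : 0 < δ) (hκ : 0 ≤ κ)
    (hs : 0 ≤ s) (hL : 0 ≤ L) (hτ0 : 0 ≤ τ) (hτ1 : τ ≤ 1) (hτ : 2 * τ ^ κ ≤ 1)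
    (hX : δ ≤ L * A ^ (n + 1)) :
    2 * pieceBound l A s κ δ η n (τ * L) ≤ pieceBound l A s κ δ η (n + 1) L := by
  have hA0 : 0 ≤ A := by linarith
  unfold pieceBound
  -- Since the power is at least 1, even the doubled 1 from the maximum lies below twice the power.
  have hX1 : 1 ≤ (L * A ^ (n + 1) / δ) ^ κ := Real.one_le_rpow ((one_le_div hδ).2 hX) hκ
  have h1 : 2 * max 1 (2 * (τ * L * A ^ n / δ) ^ κ) ≤ max 1 (2 * (L * A ^ (n + 1) / δ) ^ κ) := by
    refine le_trans ?_ (le_max_right _ _)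
    gcongr
    refine max_le hX1 ?_
    have : (τ * L * A ^ n / δ) ^ κ ≤ τ ^ κ * (L * A ^ (n + 1) / δ) ^ κ := by
      rw [← Real.mul_rpow hτ0 (by positivity)]
      refine Real.rpow_le_rpow (by positivity) ?_ hκ
      rw [mul_assoc, mul_div_assoc]
      gcongr
      simp
    nlinarith
  have h2 : (n : ℝ) * l * (A ^ s) ^ n * (τ * L / η) ^ s ≤
      (n + 1 : ℕ) * l * (A ^ s) ^ (n + 1) * (L / η) ^ s := by
    gcongr
    · simp
    · exact Real.one_le_rpow hA hs
    · simp
    · nlinarith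
  rw [← mul_assoc]
  gcongr

end pieceBound

theorem dist_image_le {B : Set I} {a L : ℝ} (ha : 0 ≤ a)
    (h : ∀ y ∈ B, ∀ z ∈ B, dist (f y) (f z) ≤ a * dist y z)
    (hL : ∀ y ∈ B, ∀ z ∈ B, dist y z ≤ L) :
    ∀ y ∈ f '' B, ∀ z ∈ f '' B, dist y z ≤ a * L := by
  rintro _ ⟨y, hy, rfl⟩ _ ⟨z, hz, rfl⟩
  exact (h y hy z hz).trans (mul_le_mul_of_nonneg_left (hL y hy z hz) ha)

/-- Induction on time, for all sets and centres at once: the set is cut into parts on which f is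
monotone, and covers of their images are pulled back. `pieceBound` is designed to survive the three
possible moves: cutting a long set (second factor), mapping a short set inside one lap, and
splitting a folded short set (first factor). -/
theorem hasCover_inter_dynBall {ι : Type*} {J : ι → Set I} {l : ℕ} {A s κ η τ : ℝ}
    (hA : 1 ≤ A) (hη : 0 < η) (hδ : 0 < δ) (hκ : 0 ≤ κ) (hs : 0 ≤ s)
    (hf : ∀ y z, dist (f y) (f z) ≤ A * dist y z)
    (hJ : ∀ j, MonotoneOn f (J j) ∨ AntitoneOn f (J j))
    (hexp : HasLocalExpansion f J l s ε (A ^ s)) (hfold : HasSmallFolds f J η τ)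
    (hτ0 : 0 ≤ τ) (hτ1 : τ ≤ 1) (hτ : 2 * τ ^ κ ≤ 1) (n : ℕ) (x : I) (S : Set I) (L : ℝ)
    (hL : 0 ≤ L) (hS : ∀ y ∈ S, ∀ z ∈ S, dist y z ≤ L) :
    HasCover f δ n (S ∩ TailEntropy.dynBall f n x ε) (pieceBound l A s κ δ η n L) := by
  induction n generalizing x S L with
  | zero =>
    have hadm : IsAdmissible f δ 0 S := fun i hi => absurd hi (Nat.not_lt_zero i)
    exact hadm.hasCover.mono Set.inter_subset_left
      (one_le_pieceBound (by linarith) hη.le hL)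
  | succ n ih =>
    have hA0 : 0 ≤ A := by linarith
    have piece : ∀ (B : Set I) (a : ℝ), 0 ≤ a → B ⊆ S →
        (MonotoneOn f B ∨ AntitoneOn f B) →
        (∀ y ∈ B, ∀ z ∈ B, dist (f y) (f z) ≤ a * dist y z) →
        HasCover f δ (n + 1) (B ∩ f ⁻¹' TailEntropy.dynBall f n (f x) ε)
          (pieceBound l A s κ δ η n (a * L)) := by
      intro B a ha hBS hB hLip
      exact HasCover.preimage hB (ih (f x) (f '' B) (a * L) (by positivity)
        (dist_image_le ha hLip fun y hy z hz => hS y (hBS hy) z (hBS hz)))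
    have hmono : ∀ {B j}, B ⊆ J j → MonotoneOn f B ∨ AntitoneOn f B := fun {B j} h =>
      (hJ j).imp (fun g => g.mono h) (fun g => g.mono h)
    -- Very short sets are already admissible; for the others the reverse inequality is what the
    -- fold step requires.
    by_cases hX : L * A ^ (n + 1) < δ
    · have := isAdmissible_of_dist_le (n := n + 1) hA hf hS (by rwa [mul_comm])
      exact this.hasCover.mono Set.inter_subset_left (one_le_pieceBound hA0 hη.le hL)
    rw [not_lt] at hX
    rw [dynBall_succ]
    rcases le_or_gt η L with hηL | hηL
    · obtain ⟨T, a, hT, ha, hcov, hLip, hsum⟩ := hexp x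
      have hc := HasCover.biUnion (T := T) fun j hj =>
        -- The local constant `a j` may exceed the global constant `A`, whereas the first factor of
        -- `pieceBound` tolerates only `A`.
        piece (S ∩ (J j ∩ Metric.ball x ε)) (min (a j) A) (le_min (ha j) hA0)
          Set.inter_subset_left (hmono (Set.inter_subset_right.trans Set.inter_subset_left))
          fun y hy z hz => by
            rw [min_mul_of_nonneg _ _ dist_nonneg]
            exact le_min (hLip j hj y hy.2 z hz.2) (hf y z)
      refine hc.mono ?_ (sum_pieceBound_le hA hη hδ hκ hs hηL hT ha hsum)
      rintro y ⟨hyS, hyB, hyD⟩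
      obtain ⟨j, hj, hyj⟩ := Set.mem_iUnion₂.1 (hcov hyB)
      exact Set.mem_iUnion₂.2 ⟨j, hj, ⟨hyS, hyj, hyB⟩, hyD⟩
    · rcases hfold S fun y hy z hz => (hS y hy z hz).trans_lt hηL with ⟨j, hj⟩ | ⟨i, j, hij, hLip⟩
      · exact (piece S A hA0 le_rfl (hmono hj) fun y _ z _ => hf y z).mono
          (fun y hy => ⟨hy.1, hy.2.2⟩) (pieceBound_lipschitz_le hA hη hδ hκ hs hL)
      · have hc := HasCover.biUnion (T := Finset.univ) fun b (_ : b ∈ Finset.univ) =>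
          piece (S ∩ J (bif b then i else j)) τ hτ0 Set.inter_subset_left
            (hmono Set.inter_subset_right) fun y hy z hz => hLip y hy.1 z hz.1
        refine hc.mono ?_ (le_trans (by simp [two_mul])
          (two_mul_pieceBound_le hA hη hδ hκ hs hL hτ0 hτ1 hτ hX))
        rintro y ⟨hyS, hyB, hyD⟩
        rcases hij hyS with hy | hy
        · exact Set.mem_iUnion₂.2 ⟨true, Finset.mem_univ _, ⟨hyS, hy⟩, hyD⟩
        · exact Set.mem_iUnion₂.2 ⟨false, Finset.mem_univ _, ⟨hyS, hy⟩, hyD⟩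

/-- If the folds of `f` at small scales are arbitrarily strong contractions, then the tail entropy
is bounded by the logarithm of the local expansion. -/
theorem tailEntropyAt_le_of_localExpansion {ι : Type*} {J : ι → Set I} {l : ℕ} {A s : ℝ}
    (hA : 1 ≤ A) (hs : 0 ≤ s) (hf : ∀ y z, dist (f y) (f z) ≤ A * dist y z)
    (hJ : ∀ j, MonotoneOn f (J j) ∨ AntitoneOn f (J j))
    (hexp : HasLocalExpansion f J l s ε (A ^ s))
    (hfold : ∀ τ > 0, ∃ η > 0, HasSmallFolds f J η τ) (hδ : 0 < δ) :
    TailEntropy.tailEntropyAt f ε δ ≤ (s * Real.log A : ℝ) := by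
  have hA0 : 0 < A := by linarith
  have key : ∀ κ > 0, TailEntropy.tailEntropyAt f ε δ ≤ ((s + κ) * Real.log A : ℝ) := by
    intro κ hκ
    -- This makes 2 τ^κ = 1. The scale `η` obtained from `τ` enters only the constant in front of
    -- the exponential.
    set τ : ℝ := (1 / 2) ^ (1 / κ) with hτ
    have hτ0 : 0 < τ := by positivity
    have hτ1 : τ ≤ 1 := Real.rpow_le_one (by norm_num) (by norm_num) (by positivity)
    have hτ2 : 2 * τ ^ κ ≤ 1 := by
      rw [hτ, ← Real.rpow_mul (by norm_num), one_div_mul_cancel hκ.ne', Real.rpow_one]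
      norm_num
    obtain ⟨η, hη, hη2⟩ := hfold τ hτ0
    set D : ℝ := max 1 (2 * (1 / δ) ^ κ) with hD
    have hD1 : 1 ≤ D := le_max_left _ _
    set E : ℝ := l * (1 / η) ^ s with hE
    have hE0 : 0 ≤ E := by positivity
    have h := tailEntropyAt_le_of_hasCover (f := f) (ε := ε) hδ (C := D * (1 + E))
      (q := A ^ κ * A ^ s) (by positivity) (by positivity) fun n x =>
        (hasCover_inter_dynBall hA hη hδ hκ.le hs hf hJ hexp hη2 hτ0.le hτ1 hτ2 n x Set.univ 1
          zero_le_one (fun y _ z _ => by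
            rw [Subtype.dist_eq]
            exact Real.dist_le_of_mem_Icc_01 y.2 z.2)).mono (by rw [Set.univ_inter]) ?_
    · rw [← Real.rpow_add hA0, Real.log_rpow hA0, add_comm] at h
      exact h
    · unfold pieceBound
      have hq1 : 1 ≤ (A ^ κ) ^ n := one_le_pow₀ (Real.one_le_rpow hA hκ.le)
      have hG1 : 1 ≤ (A ^ s) ^ n := one_le_pow₀ (Real.one_le_rpow hA hs)
      have h1 : max 1 (2 * (1 * A ^ n / δ) ^ κ) ≤ D * (A ^ κ) ^ n := by
        refine max_le (by nlinarith) ?_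
        have : (1 * A ^ n / δ) ^ κ = (1 / δ) ^ κ * (A ^ κ) ^ n := by
          rw [one_mul, div_eq_mul_one_div, mul_comm, Real.mul_rpow (by positivity) (by positivity),
            Real.rpow_pow_comm hA0.le]
        rw [this, ← mul_assoc]
        gcongr
        exact le_max_right _ _
      have h2 : 1 + n * l * (A ^ s) ^ n * (1 / η) ^ s ≤ (1 + E) * (n + 1) * (A ^ s) ^ n := by
        have hn : (0 : ℝ) ≤ n := n.cast_nonneg
        have : (n : ℝ) * l * (A ^ s) ^ n * (1 / η) ^ s = n * E * (A ^ s) ^ n := by rw [hE]; ring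
        rw [this]
        have h3 : 0 ≤ (n + E) * (A ^ s) ^ n := by positivity
        nlinarith
      calc _ ≤ D * (A ^ κ) ^ n * ((1 + E) * (n + 1) * (A ^ s) ^ n) := by gcongr
        _ = _ := by rw [mul_pow]; ring
  have hlim : Tendsto (fun κ : ℝ => (((s + κ) * Real.log A : ℝ) : EReal)) (𝓝[>] 0)
      (𝓝 ((s * Real.log A : ℝ) : EReal)) := by
    refine (continuous_coe_real_ereal.tendsto _).comp (Tendsto.mono_left ?_ nhdsWithin_le_nhds)
    have : Continuous fun κ : ℝ => (s + κ) * Real.log A := by fun_prop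
    simpa using this.tendsto 0
  exact ge_of_tendsto hlim (eventually_nhdsWithin_of_forall key)

end

/-! ### Zeros of the derivative and interpolation bounds -/

section

/-- Rolle's theorem for a chain of derivatives: if `g 0` has `k + 1` zeros then `g k` has a zero. -/
theorem exists_zero_of_card_zeros {a b : ℝ} (k : ℕ) (g : ℕ → ℝ → ℝ)
    (hg : ∀ i < k, ∀ x ∈ Set.Icc a b, HasDerivWithinAt (g i) (g (i + 1) x) (Set.Icc a b) x)
    (P : Finset ℝ) (hP : ∀ p ∈ P, p ∈ Set.Icc a b) (hcard : k + 1 ≤ P.card)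
    (hzero : ∀ p ∈ P, g 0 p = 0) : ∃ ξ ∈ Set.Icc a b, g k ξ = 0 := by
  classical
  induction k generalizing g P with
  | zero =>
    obtain ⟨p, hp⟩ := Finset.card_pos.1 (by omega : 0 < P.card)
    exact ⟨p, hP p hp, hzero p hp⟩
  | succ k ih =>
    have hrolle : ∀ x y : ℝ, ∃ z, x ∈ P → y ∈ P → x < y → x < z ∧ z < y ∧ g 1 z = 0 := by
      intro x y
      by_cases h : x ∈ P ∧ y ∈ P ∧ x < y
      · obtain ⟨hx, hy, hxy⟩ := h
        have hsub : Set.Icc x y ⊆ Set.Icc a b := Set.Icc_subset_Icc (hP x hx).1 (hP y hy).2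
        obtain ⟨z, hz, hz0⟩ := exists_hasDerivAt_eq_zero (f := g 0) (f' := g 1) hxy
          (fun t ht => ((hg 0 (Nat.succ_pos k) t (hsub ht)).continuousWithinAt).mono hsub)
          (by rw [hzero x hx, hzero y hy]) (fun t ht =>
            ((hg 0 (Nat.succ_pos k) t (hsub (Set.Ioo_subset_Icc_self ht))).mono hsub).hasDerivAt
              (Icc_mem_nhds ht.1 ht.2))
        exact ⟨z, fun _ _ _ => ⟨hz.1, hz.2, hz0⟩⟩
      · exact ⟨0, fun hx hy hxy => absurd ⟨hx, hy, hxy⟩ h⟩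
    choose z hz using hrolle
    -- A Rolle point is taken for every ordered pair of zeros, not only for neighbours; interleaving
    -- alone shows that at most one zero is lost.
    set Q : Finset ℝ := ((P ×ˢ P).filter fun q => q.1 < q.2).image fun q => z q.1 q.2 with hQ
    have hmem : ∀ q ∈ Q, q ∈ Set.Icc a b ∧ g 1 q = 0 := by
      intro q hq
      obtain ⟨⟨x, y⟩, hxy, rfl⟩ := Finset.mem_image.1 hq
      obtain ⟨hxyP, hlt⟩ := Finset.mem_filter.1 hxy
      obtain ⟨hx, hy⟩ := Finset.mem_product.1 hxyP
      obtain ⟨h1, h2, h3⟩ := hz x y hx hy hlt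
      exact ⟨⟨(hP x hx).1.trans h1.le, h2.le.trans (hP y hy).2⟩, h3⟩
    have hle : P.card ≤ Q.card + 1 := Finset.card_le_of_interleaved fun x hx y hy hxy _ =>
      ⟨z x y, Finset.mem_image.2 ⟨(x, y), Finset.mem_filter.2
        ⟨Finset.mem_product.2 ⟨hx, hy⟩, hxy⟩, rfl⟩, (hz x y hx hy hxy).1, (hz x y hx hy hxy).2.1⟩
    exact ih (fun i => g (i + 1)) (fun i hi => hg (i + 1) (Nat.succ_lt_succ hi)) Q
      (fun q hq => (hmem q hq).1) (by omega) fun q hq => (hmem q hq).2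

/-- The bound for a function with `k` zeros in terms of its `k`-th derivative. -/
theorem abs_le_prod_of_zeros {a b M : ℝ} (g : ℕ → ℝ → ℝ) (P : Finset ℝ)
    (hg : ∀ i < P.card, ∀ x ∈ Set.Icc a b, HasDerivWithinAt (g i) (g (i + 1) x) (Set.Icc a b) x)
    (hM : ∀ x ∈ Set.Icc a b, |g P.card x| ≤ M) (hP : ∀ p ∈ P, p ∈ Set.Icc a b)
    (hzero : ∀ p ∈ P, g 0 p = 0) {y : ℝ} (hy : y ∈ Set.Icc a b) :
    |g 0 y| ≤ M * (∏ p ∈ P, |y - p|) / (P.card).factorial := by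
  classical
  have hM0 : 0 ≤ M := (abs_nonneg _).trans (hM y hy)
  by_cases hyP : y ∈ P
  · rw [hzero y hyP, abs_zero]
    positivity
  set k := P.card with hk
  set p : Polynomial ℝ := ∏ q ∈ P, (Polynomial.X - Polynomial.C q) with hp
  have hmonic : p.Monic := Polynomial.monic_prod_of_monic _ _ fun q _ => Polynomial.monic_X_sub_C q
  have hdeg : p.natDegree = k := by
    rw [hp, Polynomial.natDegree_prod_of_monic _ _ fun q _ => Polynomial.monic_X_sub_C q]
    simp [hk]
  have heval : ∀ t, p.eval t = ∏ q ∈ P, (t - q) := fun t => by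
    rw [hp, Polynomial.eval_prod]; simp
  have hpy : p.eval y ≠ 0 := by
    rw [heval, Finset.prod_ne_zero_iff]
    intro q hq h
    exact hyP (by rwa [sub_eq_zero.1 h])
  have hlast : ∀ t, (Polynomial.derivative^[k] p).eval t = k.factorial := by
    intro t
    have h1 : (Polynomial.derivative^[k] p).natDegree ≤ 0 := by
      have := Polynomial.natDegree_iterate_derivative p k
      omega
    rw [Polynomial.eq_C_of_natDegree_le_zero h1, Polynomial.eval_C,
      Polynomial.coeff_iterate_derivative, zero_add, Nat.descFactorial_self]
    have : p.coeff k = 1 := by rw [← hdeg]; exact hmonic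
    rw [this]
    simp
  -- With this `c`, the function g 0 - c p vanishes at `y` as well as on `P`. A zero of its k-th
  -- derivative then identifies `c` with g k ξ / k!.
  set c : ℝ := g 0 y / p.eval y with hc
  obtain ⟨ξ, hξ, hξ0⟩ := exists_zero_of_card_zeros (a := a) (b := b) k
    (fun i t => g i t - c * (Polynomial.derivative^[i] p).eval t)
    (fun i hi x hx => by
      refine (hg i hi x hx).sub ?_
      rw [Function.iterate_succ_apply']
      exact (((Polynomial.derivative^[i] p).hasDerivAt x).const_mul c).hasDerivWithinAt)
    (insert y P)
    (fun q hq => by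
      rcases Finset.mem_insert.1 hq with rfl | h
      · exact hy
      · exact hP q h)
    (by rw [Finset.card_insert_of_notMem hyP])
    (fun q hq => by
      rcases Finset.mem_insert.1 hq with rfl | h
      · simp only [Function.iterate_zero, id, hc]
        field_simp
        ring
      · have : p.eval q = 0 := by
          rw [heval]
          exact Finset.prod_eq_zero h (sub_self q)
        simp [this, hzero q h])
  have hg_eq : g k ξ = c * k.factorial := by
    have := hξ0
    simp only [hlast] at this
    linarith
  have hfac : (0 : ℝ) < k.factorial := by exact_mod_cast k.factorial_pos
  have hcM : |c| * k.factorial ≤ M := by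
    have := hM ξ hξ
    rwa [hg_eq, abs_mul, abs_of_pos hfac] at this
  have hgy : g 0 y = c * p.eval y := by rw [hc]; field_simp
  rw [hgy, abs_mul, heval, Finset.abs_prod, le_div_iff₀ hfac]
  have hprod : 0 ≤ ∏ q ∈ P, |y - q| := Finset.prod_nonneg fun _ _ => abs_nonneg _
  nlinarith

variable {f : I → I} {l : ℕ}

theorem toReal_coe (x : I) : toReal f x = f x := Set.IccExtend_val _ _ x

theorem IsCr.hasDerivWithinAt (h : IsCr l f) {i : ℕ} (hi : i < l) {x : ℝ} (hx : x ∈ I) :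
    HasDerivWithinAt (iteratedDerivWithin i (toReal f) I)
      (iteratedDerivWithin (i + 1) (toReal f) I x) I x := by
  rw [iteratedDerivWithin_succ]
  exact ((ContDiffOn.differentiableOn_iteratedDerivWithin h (by exact_mod_cast hi)
    (uniqueDiffOn_Icc zero_lt_one)) x hx).hasDerivWithinAt

theorem derivSupNorm_nonneg (k : ℕ) : 0 ≤ derivSupNorm k f :=
  Real.iSup_nonneg fun _ => abs_nonneg _

theorem crNorm_nonneg : 0 ≤ crNorm l f := Real.iSup_nonneg fun _ => derivSupNorm_nonneg _

theorem IsCr.abs_iteratedDerivWithin_le (h : IsCr l f) {k : ℕ} (hk1 : 1 ≤ k) (hkl : k ≤ l) {x : ℝ}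
    (hx : x ∈ I) : |iteratedDerivWithin k (toReal f) I x| ≤ crNorm l f := by
  have hcont : ContinuousOn (fun x => |iteratedDerivWithin k (toReal f) I x|) I :=
    (ContDiffOn.continuousOn_iteratedDerivWithin h (by exact_mod_cast hkl)
      (uniqueDiffOn_Icc zero_lt_one)).abs
  have hbdd : BddAbove (Set.range fun x : I => |iteratedDerivWithin k (toReal f) I x|) := by
    have := (isCompact_Icc (a := (0 : ℝ)) (b := 1)).bddAbove_image hcont
    rwa [Set.image_eq_range] at this
  have h1 : |iteratedDerivWithin k (toReal f) I x| ≤ derivSupNorm k f :=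
    le_ciSup hbdd (⟨x, hx⟩ : I)
  exact h1.trans (le_ciSup (f := fun k : Finset.Icc 1 l => derivSupNorm k f)
    (Set.finite_range _).bddAbove ⟨k, Finset.mem_Icc.2 ⟨hk1, hkl⟩⟩)

/-- The first derivative is small near the common zeros. -/
theorem IsCr.abs_deriv_le_prod (h : IsCr l f) (P : Finset ℝ) (hcard : P.card + 1 ≤ l)
    (hP : ∀ p ∈ P, p ∈ I ∧ iteratedDerivWithin 1 (toReal f) I p = 0) {y : ℝ} (hy : y ∈ I) :
    |iteratedDerivWithin 1 (toReal f) I y| ≤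
      crNorm l f * (∏ p ∈ P, |y - p|) / (P.card).factorial :=
  abs_le_prod_of_zeros (fun i => iteratedDerivWithin (i + 1) (toReal f) I) P
    (fun i hi x hx => h.hasDerivWithinAt (by omega) hx)
    (fun x hx => h.abs_iteratedDerivWithin_le (by omega) hcard hx)
    (fun p hp => (hP p hp).1) (fun p hp => (hP p hp).2) hy

theorem IsCr.hasDerivWithinAt_toReal (h : IsCr l f) (hl : 1 ≤ l) {x : ℝ} (hx : x ∈ I) :
    HasDerivWithinAt (toReal f) (iteratedDerivWithin 1 (toReal f) I x) I x := by
  have := h.hasDerivWithinAt (i := 0) hl hx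
  rwa [iteratedDerivWithin_zero] at this

theorem IsCr.dist_le_of_abs_deriv_le (h : IsCr l f) (hl : 1 ≤ l) {D : Set ℝ} (hD : Convex ℝ D)
    (hDI : D ⊆ I) {a : ℝ} (ha : ∀ t ∈ D, |iteratedDerivWithin 1 (toReal f) I t| ≤ a) {y z : I}
    (hy : (y : ℝ) ∈ D) (hz : (z : ℝ) ∈ D) : dist (f y) (f z) ≤ a * dist y z := by
  have := hD.norm_image_sub_le_of_norm_hasDerivWithin_le
    (fun t ht => (h.hasDerivWithinAt_toReal hl (hDI ht)).mono hDI) ha hz hy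
  rwa [toReal_coe, toReal_coe, Real.norm_eq_abs, Real.norm_eq_abs, ← Real.dist_eq,
    ← Real.dist_eq, ← Subtype.dist_eq, ← Subtype.dist_eq] at this

theorem IsCr.dist_le (h : IsCr l f) (hl : 1 ≤ l) (y z : I) :
    dist (f y) (f z) ≤ max 1 (crNorm l f) * dist y z :=
  h.dist_le_of_abs_deriv_le hl (convex_Icc 0 1) subset_rfl (fun _ ht =>
    (h.abs_iteratedDerivWithin_le le_rfl hl ht).trans (le_max_right _ _)) y.2 z.2

/-- As the lap is nondegenerate, the derivative within it agrees with the derivative within `I`,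
even at its endpoints. -/
theorem IsCr.deriv_nonneg_of_monotoneOn (h : IsCr l f) (hl : 1 ≤ l) {a b x : I} (hab : a < b)
    (hf : MonotoneOn f (Set.Icc a b)) (hx : x ∈ Set.Icc a b) :
    0 ≤ iteratedDerivWithin 1 (toReal f) I x := by
  have hsub : Set.Icc (a : ℝ) b ⊆ I := Set.Icc_subset_Icc a.2.1 b.2.2
  have hd := (h.hasDerivWithinAt_toReal hl x.2).mono hsub
  have hx' : (x : ℝ) ∈ Set.Icc (a : ℝ) b := hx
  rw [← hd.derivWithin (uniqueDiffOn_Icc (by exact_mod_cast hab) _ hx')]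
  refine MonotoneOn.derivWithin_nonneg fun s hs t ht hst => ?_
  have := hf (a := ⟨s, hsub hs⟩) hs (b := ⟨t, hsub ht⟩) ht hst
  rw [show s = ((⟨s, hsub hs⟩ : I) : ℝ) from rfl, show t = ((⟨t, hsub ht⟩ : I) : ℝ) from rfl,
    toReal_coe, toReal_coe]
  exact this

theorem IsCr.deriv_nonpos_of_antitoneOn (h : IsCr l f) (hl : 1 ≤ l) {a b x : I} (hab : a < b)
    (hf : AntitoneOn f (Set.Icc a b)) (hx : x ∈ Set.Icc a b) :
    iteratedDerivWithin 1 (toReal f) I x ≤ 0 := by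
  have hsub : Set.Icc (a : ℝ) b ⊆ I := Set.Icc_subset_Icc a.2.1 b.2.2
  have hd := (h.hasDerivWithinAt_toReal hl x.2).mono hsub
  have hx' : (x : ℝ) ∈ Set.Icc (a : ℝ) b := hx
  rw [← hd.derivWithin (uniqueDiffOn_Icc (by exact_mod_cast hab) _ hx')]
  refine AntitoneOn.derivWithin_nonpos fun s hs t ht hst => ?_
  have := hf (a := ⟨s, hsub hs⟩) hs (b := ⟨t, hsub ht⟩) ht hst
  rw [show s = ((⟨s, hsub hs⟩ : I) : ℝ) from rfl, show t = ((⟨t, hsub ht⟩ : I) : ℝ) from rfl,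
    toReal_coe, toReal_coe]
  exact this

end

/-! ### Laps, turning points and numerical inequalities -/

section

variable {f : I → I} {l : ℕ} {ε : ℝ}

/-- The `j`-th lap of a subdivision. -/
def lap (c : Fin (l + 1) → I) (j : Fin l) : Set I := Set.Icc (c j.castSucc) (c j.succ)

/-- Two consecutive laps with the same direction of monotonicity can be merged. -/
theorem IsMonotoneSubdivision.merge {m : ℕ} {c : Fin (m + 2) → I}
    (hc : IsMonotoneSubdivision f (m + 1) c) (i : Fin (m + 1)) (hi : 0 < i.val)
    (hmerge : ∀ a b : Fin (m + 2), a.val + 1 = i.val → b.val = i.val + 1 →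
      MonotoneOn f (Set.Icc (c a) (c b)) ∨ AntitoneOn f (Set.Icc (c a) (c b))) :
    ∃ c', IsMonotoneSubdivision f m c' := by
  obtain ⟨hmono, h0, h1, hlap⟩ := hc
  have hlap' : ∀ a b : Fin (m + 2), b.val = a.val + 1 →
      MonotoneOn f (Set.Icc (c a) (c b)) ∨ AntitoneOn f (Set.Icc (c a) (c b)) := by
    intro a b hab
    have := hlap ⟨a.val, by omega⟩
    rwa [show Fin.castSucc ⟨a.val, by omega⟩ = a from Fin.ext rfl,
      show Fin.succ ⟨a.val, by omega⟩ = b from Fin.ext hab.symm] at this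
  have hval : ∀ j : Fin (m + 1), (i.castSucc.succAbove j).val =
      if j.val < i.val then j.val else j.val + 1 := by
    intro j
    simp only [Fin.succAbove, Fin.lt_def, Fin.val_castSucc]
    split_ifs <;> simp
  -- `succAbove` deletes the breakpoint of index `i`; each new lap is an old one, except the merged
  -- lap, for which j + 1 = i.
  refine ⟨fun j => c (i.castSucc.succAbove j), hmono.comp (Fin.strictMono_succAbove _), ?_, ?_, ?_⟩
  · refine (congrArg c (Fin.ext ?_)).trans h0
    rw [hval]
    simp [hi]
  · refine (congrArg c (Fin.ext ?_)).trans h1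
    rw [hval]
    have := i.2
    simp only [Fin.val_last]
    split_ifs <;> omega
  · intro j
    have ha := hval j.castSucc
    have hb := hval j.succ
    simp only [Fin.val_castSucc, Fin.val_succ] at ha hb
    by_cases h : j.val + 1 = i.val
    · refine hmerge _ _ ?_ ?_
      · rw [ha]; split_ifs <;> omega
      · rw [hb]; split_ifs <;> omega
    · refine hlap' _ _ ?_
      rw [ha, hb]
      split_ifs <;> omega

/-- The derivative vanishes at the interior endpoints of a minimal subdivision. -/
theorem IsCr.deriv_eq_zero (h : IsCr l f) (hleast : ∀ k c, IsMonotoneSubdivision f k c → l ≤ k)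
    {c : Fin (l + 1) → I} (hc : IsMonotoneSubdivision f l c) (i : Fin l) (hi : 0 < i.val) :
    iteratedDerivWithin 1 (toReal f) I (c i.castSucc) = 0 := by
  by_contra hne
  obtain ⟨m, rfl⟩ : ∃ m, l = m + 1 := ⟨l - 1, by have := i.2; omega⟩
  have hl : 1 ≤ m + 1 := by omega
  suffices h' : ∃ c', IsMonotoneSubdivision f m c' by
    obtain ⟨c', hc'⟩ := h'
    have := hleast m c' hc'
    omega
  refine hc.merge i hi fun a b ha hb => ?_
  obtain ⟨hmono, -, -, hlap⟩ := hc
  have hleft := hlap ⟨a.val, by omega⟩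
  have hright := hlap i
  rw [show Fin.castSucc ⟨a.val, by omega⟩ = a from Fin.ext rfl,
    show Fin.succ ⟨a.val, by omega⟩ = i.castSucc from Fin.ext ha] at hleft
  rw [show i.succ = b from Fin.ext hb.symm] at hright
  have hai : c a < c i.castSucc := hmono (Fin.lt_def.2 (by simp; omega))
  have hib : c i.castSucc < c b := hmono (Fin.lt_def.2 (by simp; omega))
  have hg : IsGreatest (Set.Icc (c a) (c i.castSucc)) (c i.castSucc) := isGreatest_Icc hai.le
  have hs : IsLeast (Set.Icc (c i.castSucc) (c b)) (c i.castSucc) := isLeast_Icc hib.le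
  rw [← Set.Icc_union_Icc_eq_Icc hai.le hib.le]
  rcases hleft with hL | hL <;> rcases hright with hR | hR
  · exact Or.inl (hL.union_right hR hg hs)
  · exact absurd (le_antisymm (h.deriv_nonpos_of_antitoneOn hl hib hR hs.1)
      (h.deriv_nonneg_of_monotoneOn hl hai hL hg.1)) hne
  · exact absurd (le_antisymm (h.deriv_nonpos_of_antitoneOn hl hai hL hg.1)
      (h.deriv_nonneg_of_monotoneOn hl hib hR hs.1)) hne
  · exact Or.inr (hL.union_right hR hg hs)

theorem IsMonotoneSubdivision.exists_mem_lap {c : Fin (l + 1) → I}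
    (hc : IsMonotoneSubdivision f l c) (x : I) : ∃ j, x ∈ lap c j := by
  obtain ⟨-, h0, h1, -⟩ := hc
  have key : ∀ k : ℕ, ∀ hk : k < l + 1, x ≤ c ⟨k, hk⟩ → 0 < k → ∃ j, x ∈ lap c j := by
    intro k
    induction k with
    | zero => intro _ _ h; exact absurd h (lt_irrefl 0)
    | succ k ih =>
      intro hk hx _
      by_cases hxk : c ⟨k, by omega⟩ ≤ x
      · exact ⟨⟨k, by omega⟩, hxk, hx⟩
      · rcases Nat.eq_zero_or_pos k with rfl | hk0
        · exact absurd (h0.le.trans x.2.1) hxk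
        · exact ih (by omega) (not_le.1 hxk).le hk0
  have hl : 0 < l := by
    rcases Nat.eq_zero_or_pos l with rfl | hl
    · exact absurd (h0.symm.trans h1) zero_ne_one
    · exact hl
  exact key l (Nat.lt_succ_self l) (x.2.2.trans h1.ge) hl

theorem IsMonotoneSubdivision.exists_gap {c : Fin (l + 1) → I}
    (hc : IsMonotoneSubdivision f l c) :
    ∃ γ > 0, ∀ j : Fin l, γ ≤ (c j.succ : ℝ) - c j.castSucc := by
  obtain ⟨j, -⟩ := hc.exists_mem_lap 0
  have : Nonempty (Fin l) := ⟨j⟩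
  obtain ⟨i, hi⟩ := Finite.exists_min fun j : Fin l => (c j.succ : ℝ) - c j.castSucc
  exact ⟨_, sub_pos.2 (hc.1 Fin.castSucc_lt_succ), hi⟩

/-- A set shorter than every lap that is not inside one lap straddles a single breakpoint p, at
which f' vanishes. As then l ≥ 2, f'' is bounded by A and |f'(t)| ≤ A |t - p|, which is at most `τ`
within distance τ/A of p. -/
theorem IsCr.hasSmallFolds (h : IsCr l f) (hleast : ∀ k c, IsMonotoneSubdivision f k c → l ≤ k)
    {c : Fin (l + 1) → I} (hc : IsMonotoneSubdivision f l c) {τ : ℝ} (hτ : 0 < τ) :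
    ∃ η > 0, HasSmallFolds f (lap c) η τ := by
  obtain ⟨γ, hγ, hgap⟩ := hc.exists_gap
  obtain ⟨j₀, -⟩ := hc.exists_mem_lap 0
  set A := max 1 (crNorm l f) with hA
  have hA0 : 0 < A := zero_lt_one.trans_le (le_max_left _ _)
  refine ⟨min γ (τ / A), lt_min hγ (by positivity), fun S hS => ?_⟩
  have hclose : ∀ y ∈ S, ∀ z ∈ S, |(y : ℝ) - z| < γ ∧ |(y : ℝ) - z| < τ / A := fun y hy z hz => by
    have := hS y hy z hz
    rwa [Subtype.dist_eq, Real.dist_eq, lt_min_iff] at this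
  rcases S.eq_empty_or_nonempty with rfl | ⟨y₀, hy₀⟩
  · exact Or.inl ⟨j₀, Set.empty_subset _⟩
  have fold : ∀ i : Fin l, 0 < i.val → (∃ y ∈ S, y ≤ c i.castSucc) →
      (∃ z ∈ S, c i.castSucc ≤ z) → (∃ j, S ⊆ lap c j) ∨
      ∃ i j, S ⊆ lap c i ∪ lap c j ∧ ∀ y ∈ S, ∀ z ∈ S, dist (f y) (f z) ≤ τ * dist y z := by
    rintro i hi ⟨y, hy, hyi⟩ ⟨z, hz, hzi⟩
    have hyi' : (y : ℝ) ≤ c i.castSucc := hyi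
    have hzi' : (c i.castSucc : ℝ) ≤ z := hzi
    set p : ℝ := ((c i.castSucc : I) : ℝ) with hp
    have near : ∀ w ∈ S, |(w : ℝ) - p| < γ ∧ |(w : ℝ) - p| < τ / A := by
      intro w hw
      have h1 := hclose w hw y hy
      have h2 := hclose w hw z hz
      simp only [abs_lt] at h1 h2 ⊢
      constructor <;> constructor <;> linarith
    let i' : Fin l := ⟨i.val - 1, by omega⟩
    have hi' : i'.succ = i.castSucc := Fin.ext (by simp [i']; omega)
    refine Or.inr ⟨i', i, fun w hw => ?_, fun u hu v hv => ?_⟩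
    · have hw' := abs_lt.1 (near w hw).1
      rcases le_total w (c i.castSucc) with hle | hle
      · refine Or.inl ⟨?_, hi' ▸ hle⟩
        have := hgap i'
        rw [hi'] at this
        exact Subtype.coe_le_coe.1 (by linarith)
      · refine Or.inr ⟨hle, ?_⟩
        have := hgap i
        exact Subtype.coe_le_coe.1 (by linarith)
    · refine h.dist_le_of_abs_deriv_le (D := I ∩ Metric.ball p (τ / A)) (by have := i.2; omega)
        ((convex_Icc 0 1).inter (convex_ball _ _)) Set.inter_subset_left ?_
        ⟨u.2, (near u hu).2⟩ ⟨v.2, (near v hv).2⟩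
      rintro t ⟨ht, htp⟩
      have := h.abs_deriv_le_prod {p} (by have := i.2; simp; omega)
        (fun q hq => by
          rw [Finset.mem_singleton.1 hq]
          exact ⟨(c i.castSucc).2, h.deriv_eq_zero hleast hc i hi⟩) ht
      simp only [Finset.prod_singleton, Finset.card_singleton, Nat.factorial_one, Nat.cast_one,
        div_one] at this
      refine this.trans ?_
      calc crNorm l f * |t - p| ≤ A * (τ / A) := by
            have h2 : |t - p| < τ / A := htp
            gcongr
            exact le_max_right _ _
        _ = τ := by field_simp
  obtain ⟨j, hj⟩ := hc.exists_mem_lap y₀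
  by_cases hsub : S ⊆ lap c j
  · exact Or.inl ⟨j, hsub⟩
  obtain ⟨z, hz, hzj⟩ := Set.not_subset.1 hsub
  rcases lt_or_ge z (c j.castSucc) with hlt | hge
  · refine fold j ?_ ⟨z, hz, hlt.le⟩ ⟨y₀, hy₀, hj.1⟩
    by_contra h0
    have : j.castSucc = 0 := Fin.ext (by simpa using h0)
    rw [this, hc.2.1] at hlt
    exact absurd z.2.1 (not_le.2 hlt)
  · have hgt : c j.succ < z := not_le.1 fun hle => hzj ⟨hge, hle⟩
    have hjl : j.val + 1 < l := by
      by_contra hnot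
      have : j.succ = Fin.last l := Fin.ext (by simp; omega)
      rw [this, hc.2.2.1] at hgt
      exact absurd z.2.2 (not_le.2 hgt)
    have he : (⟨j.val + 1, hjl⟩ : Fin l).castSucc = j.succ := rfl
    exact fold ⟨j.val + 1, hjl⟩ (Nat.succ_pos _) ⟨y₀, hy₀, he ▸ hj.2⟩ ⟨z, hz, he ▸ hgt.le⟩

/-- The left side grows by the ratio 2(k + 4)/(k + 3) ≤ 8/3 < e. -/
theorem succ_mul_two_pow_le_exp (k : ℕ) : ((k : ℝ) + 3) * 2 ^ (k + 1) ≤ Real.exp (k + 2 : ℕ) := by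
  have he : (8 / 3 : ℝ) ≤ Real.exp 1 := by linarith [Real.exp_one_gt_d9]
  induction k with
  | zero =>
    have : Real.exp (0 + 2 : ℕ) = Real.exp 1 * Real.exp 1 := by rw [← Real.exp_add]; norm_num
    rw [this]
    norm_num
    nlinarith
  | succ k ih =>
    have : Real.exp (k + 1 + 2 : ℕ) = Real.exp (k + 2 : ℕ) * Real.exp 1 := by
      rw [← Real.exp_add]; push_cast; ring_nf
    rw [this]
    have h1 : ((k + 1 : ℕ) + 3 : ℝ) * 2 ^ (k + 1 + 1) ≤ ((k : ℝ) + 3) * 2 ^ (k + 1) * (8 / 3) := by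
      have h2 : (0 : ℝ) < 2 ^ (k + 1) := by positivity
      have hk : (0 : ℝ) ≤ k := k.cast_nonneg
      rw [pow_succ (2 : ℝ) (k + 1)]
      push_cast
      nlinarith [mul_nonneg hk h2.le]
    exact h1.trans (mul_le_mul ih he (by norm_num) (Real.exp_pos _).le)

section Exponents

variable {s M : ℝ}

/-- The contribution of a ball that contains at least two turning points. -/
theorem succ_mul_rpow_le (hε : 0 < ε) (hs0 : 0 < s) (hs1 : s ≤ 1) (hεs : ε ^ s = Real.exp (-1))
    (hM : 0 ≤ M) {k : ℕ} (hk : 2 ≤ k) :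
    ((k : ℝ) + 1) * (M * (2 * ε) ^ k / k.factorial) ^ s ≤ M ^ s := by
  obtain ⟨m, rfl⟩ : ∃ m, k = m + 2 := ⟨k - 2, by omega⟩
  -- Of the factorial only k! ≥ 2 is used: it cancels one factor 2 of 2^k, and (k + 1) 2^(k-1) ≤ e^k
  -- holds for k ≥ 2.
  have hfac : (2 : ℝ) ≤ (m + 2).factorial := by
    exact_mod_cast Nat.factorial_le (show 2 ≤ m + 2 by omega)
  have h1 : M * (2 * ε) ^ (m + 2) / (m + 2).factorial ≤ M * (ε ^ (m + 2) * 2 ^ (m + 1)) := by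
    calc M * (2 * ε) ^ (m + 2) / (m + 2).factorial ≤ M * (2 * ε) ^ (m + 2) / 2 := by gcongr
      _ = _ := by ring
  have h2 : (M * (2 * ε) ^ (m + 2) / (m + 2).factorial) ^ s ≤
      M ^ s * (Real.exp (-(m + 2 : ℕ)) * 2 ^ (m + 1)) := by
    refine (Real.rpow_le_rpow (by positivity) h1 hs0.le).trans ?_
    rw [Real.mul_rpow hM (by positivity), Real.mul_rpow (by positivity) (by positivity)]
    have h3 : (ε ^ (m + 2)) ^ s = Real.exp (-(m + 2 : ℕ)) := by
      rw [← Real.rpow_pow_comm hε.le, hεs, ← Real.exp_nat_mul]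
      ring_nf
    have h4 : ((2 : ℝ) ^ (m + 1)) ^ s ≤ 2 ^ (m + 1) := by
      have := Real.rpow_le_rpow_of_exponent_le
        (one_le_pow₀ (by norm_num) : (1 : ℝ) ≤ 2 ^ (m + 1)) hs1
      rwa [Real.rpow_one] at this
    rw [h3]
    gcongr
  have h5 := succ_mul_two_pow_le_exp m
  have hMs : 0 ≤ M ^ s := Real.rpow_nonneg hM s
  have h6 : ((m : ℝ) + 3) * 2 ^ (m + 1) * Real.exp (-(m + 2 : ℕ)) ≤ 1 := by
    calc _ ≤ Real.exp (m + 2 : ℕ) * Real.exp (-(m + 2 : ℕ)) := by gcongr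
      _ = 1 := by rw [← Real.exp_add, add_neg_cancel, Real.exp_zero]
  calc _ ≤ (((m + 2 : ℕ) : ℝ) + 1) * (M ^ s * (Real.exp (-(m + 2 : ℕ)) * 2 ^ (m + 1))) := by gcongr
    _ = M ^ s * (((m : ℝ) + 3) * 2 ^ (m + 1) * Real.exp (-(m + 2 : ℕ))) := by push_cast; ring
    _ ≤ M ^ s * 1 := by gcongr
    _ = M ^ s := mul_one _

/-- The contribution of a ball that contains one turning point. -/
theorem rpow_add_rpow_le (hs0 : 0 < s) (hs1 : s ≤ 1) (hεs : ε ^ s = Real.exp (-1))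
    (hM : 0 ≤ M) {u v : ℝ} (hu : 0 ≤ u) (hv : 0 ≤ v) (huv : u + v = 2 * ε) :
    (M * u) ^ s + (M * v) ^ s ≤ M ^ s := by
  obtain ⟨-, hconc⟩ := Real.concaveOn_rpow hs0.le hs1
  replace hconc := hconc (x := u) hu (y := v) hv (a := 1 / 2) (b := 1 / 2) (by norm_num)
    (by norm_num) (by norm_num)
  simp only [smul_eq_mul] at hconc
  have h1 : 1 / 2 * u + 1 / 2 * v = ε := by linarith
  rw [h1, hεs] at hconc
  -- Concavity gives u^s + v^s ≤ 2 ε^s = 2/e, so e ≥ 2 is enough.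
  have he : Real.exp (-1) ≤ 1 / 2 := by
    rw [Real.exp_neg, inv_le_comm₀ (Real.exp_pos 1) (by norm_num)]
    linarith [Real.exp_one_gt_d9]
  rw [Real.mul_rpow hM hu, Real.mul_rpow hM hv]
  have hMs : 0 ≤ M ^ s := Real.rpow_nonneg hM s
  nlinarith

end Exponents

end

/-! ### The local expansion estimate -/

section

variable {f : I → I} {l : ℕ} {ε : ℝ}

theorem IsCr.hasLocalExpansion (h : IsCr l f)
    (hleast : ∀ k c, IsMonotoneSubdivision f k c → l ≤ k) {c : Fin (l + 1) → I}
    (hc : IsMonotoneSubdivision f l c) {s : ℝ} (hε : 0 < ε) (hs0 : 0 < s) (hs1 : s ≤ 1)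
    (hεs : ε ^ s = Real.exp (-1)) :
    HasLocalExpansion f (lap c) l s ε (max 1 (crNorm l f) ^ s) := by
  classical
  intro x
  set M := crNorm l f with hM
  set A := max 1 M with hA
  have hM0 : 0 ≤ M := crNorm_nonneg
  have hA0 : 0 ≤ A := hM0.trans (le_max_right _ _)
  have hMA : M ^ s ≤ A ^ s := Real.rpow_le_rpow hM0 (le_max_right _ _) hs0.le
  set T : Finset (Fin l) := Finset.univ.filter fun j => (lap c j ∩ Metric.ball x ε).Nonempty
    with hT
  have hTl : T.card ≤ l := (Finset.card_le_univ _).trans (Fintype.card_fin l).le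
  have hcov : Metric.ball x ε ⊆ ⋃ j ∈ T, lap c j := fun y hy => by
    obtain ⟨j, hj⟩ := hc.exists_mem_lap y
    exact Set.mem_iUnion₂.2 ⟨j, Finset.mem_filter.2 ⟨Finset.mem_univ _, y, hj, hy⟩, hj⟩
  obtain ⟨jx, hjx⟩ := hc.exists_mem_lap x
  have hl : 1 ≤ l := by have := jx.2; omega
  have hTne : T.Nonempty :=
    ⟨jx, Finset.mem_filter.2 ⟨Finset.mem_univ _, x, hjx, Metric.mem_ball_self hε⟩⟩
  set j₀ := T.min' hTne with hj₀
  set j₁ := T.max' hTne with hj₁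
  have hj₀₁ : j₀ ≤ j₁ := Finset.min'_le_max' _ _
  have hTIcc : T ⊆ Finset.Icc j₀ j₁ := fun j hj =>
    Finset.mem_Icc.2 ⟨Finset.min'_le _ _ hj, Finset.le_max' _ _ hj⟩
  obtain ⟨y₀, hy₀, hy₀x⟩ := (Finset.mem_filter.1 (T.min'_mem hTne)).2
  obtain ⟨y₁, hy₁, hy₁x⟩ := (Finset.mem_filter.1 (T.max'_mem hTne)).2
  rw [Metric.mem_ball, Subtype.dist_eq, Real.dist_eq, abs_lt] at hy₀x hy₁x
  have hcm := hc.1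
  -- The left endpoints of all laps from `j₀` to `j₁` but the first lie between `y₀` and `y₁`, hence
  -- in the ball.
  have hbreak : ∀ i ∈ Finset.Ioc j₀ j₁, |((c i.castSucc : I) : ℝ) - x| < ε := by
    intro i hi
    obtain ⟨h0, h1⟩ := Finset.mem_Ioc.1 hi
    have ha : (y₀ : ℝ) ≤ c i.castSucc := hy₀.2.trans (hcm.monotone (by
      rw [Fin.le_def]; simpa using Nat.succ_le_of_lt (Fin.lt_def.1 h0)))
    have hb : (c i.castSucc : ℝ) ≤ y₁ := le_trans (hcm.monotone (by
      rw [Fin.le_def]; simpa using Fin.le_def.1 h1)) hy₁.1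
    rw [abs_lt]
    constructor <;> linarith
  set P : Finset ℝ := (Finset.Ioc j₀ j₁).image fun i => ((c i.castSucc : I) : ℝ) with hP
  have hPcard : P.card = j₁.val - j₀.val := by
    rw [hP, Finset.card_image_of_injective, Fin.card_Ioc]
    exact Subtype.val_injective.comp (hcm.injective.comp (Fin.castSucc_injective l))
  have hP0 : ∀ p ∈ P, p ∈ I ∧ iteratedDerivWithin 1 (toReal f) I p = 0 := by
    intro p hp
    obtain ⟨i, hi, rfl⟩ := Finset.mem_image.1 hp
    have := Fin.lt_def.1 (Finset.mem_Ioc.1 hi).1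
    exact ⟨(c i.castSucc).2, h.deriv_eq_zero hleast hc i (by omega)⟩
  have hPx : ∀ p ∈ P, |p - x| < ε := by
    intro p hp
    obtain ⟨i, hi, rfl⟩ := Finset.mem_image.1 hp
    exact hbreak i hi
  have hPl : P.card + 1 ≤ l := by have := j₁.2; omega
  have hTcard : T.card ≤ P.card + 1 := by
    have := Finset.card_le_card hTIcc
    rw [Fin.card_Icc] at this
    have := Fin.le_def.1 hj₀₁
    omega
  rcases (by omega : P.card = 0 ∨ P.card = 1 ∨ 2 ≤ P.card) with hk | hk | hk
  · refine ⟨T, fun _ => A, hTl, fun _ => hA0, hcov, fun _ _ y _ z _ => h.dist_le hl y z, ?_⟩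
    rw [Finset.sum_const, nsmul_eq_mul]
    have : (T.card : ℝ) ≤ 1 := by exact_mod_cast (by omega : T.card ≤ 1)
    have := Real.rpow_nonneg hA0 s
    nlinarith
  · set p : ℝ := ((c j₁.castSucc : I) : ℝ) with hp
    have hlt : j₀ < j₁ := Fin.lt_def.2 (by omega)
    have hpP : p ∈ P := Finset.mem_image.2 ⟨j₁, Finset.mem_Ioc.2 ⟨hlt, le_rfl⟩, rfl⟩
    have hPp : P = {p} := (Finset.eq_of_subset_of_card_le (Finset.singleton_subset_iff.2 hpP)
      (by rw [hk, Finset.card_singleton])).symm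
    have hpx := abs_lt.1 (hPx p hpP)
    have hderiv : ∀ t ∈ I, |iteratedDerivWithin 1 (toReal f) I t| ≤ M * |t - p| := by
      intro t ht
      have := h.abs_deriv_le_prod P hPl hP0 ht
      rw [hk, hPp] at this
      simpa using this
    -- The turning point p splits the interval (x - ε, x + ε) into lengths `u` and `v`, so |f'| ≤ M
    -- |t - p| is at most M u on the left and M v on the right. The uniform bound 2 M ε on both
    -- sides would be too weak for s near 1.
    set u := p - x + ε with hu
    set v := x + ε - p with hv
    have hu0 : 0 < u := by linarith
    have hv0 : 0 < v := by linarith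
    refine ⟨T, fun j => if j = j₁ then M * v else M * u, hTl, fun j => by
      dsimp only
      split_ifs <;> positivity, hcov, ?_, ?_⟩
    · intro j hj y hy z hz
      have hyx : |(y : ℝ) - x| < ε := hy.2
      have hzx : |(z : ℝ) - x| < ε := hz.2
      rw [abs_lt] at hyx hzx
      dsimp only
      split_ifs with hjj
      · subst hjj
        refine h.dist_le_of_abs_deriv_le hl (D := I ∩ Set.Icc p (x + ε))
          ((convex_Icc 0 1).inter (convex_Icc _ _)) Set.inter_subset_left ?_
          ⟨y.2, hy.1.1, by linarith⟩ ⟨z.2, hz.1.1, by linarith⟩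
        rintro t ⟨ht, htp⟩
        refine (hderiv t ht).trans (mul_le_mul_of_nonneg_left ?_ hM0)
        rw [abs_le]
        constructor <;> linarith [htp.1, htp.2]
      · have hjp : ∀ w ∈ lap c j, (w : ℝ) ≤ p := by
          intro w hw
          have h1 : j < j₁ := lt_of_le_of_ne (Finset.mem_Icc.1 (hTIcc hj)).2 hjj
          exact hw.2.trans (hcm.monotone (by
            rw [Fin.le_def]; simpa using Nat.succ_le_of_lt (Fin.lt_def.1 h1)))
        refine h.dist_le_of_abs_deriv_le hl (D := I ∩ Set.Icc (x - ε) p)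
          ((convex_Icc 0 1).inter (convex_Icc _ _)) Set.inter_subset_left ?_
          ⟨y.2, by linarith, hjp y hy.1⟩ ⟨z.2, by linarith, hjp z hz.1⟩
        rintro t ⟨ht, htp⟩
        refine (hderiv t ht).trans (mul_le_mul_of_nonneg_left ?_ hM0)
        rw [abs_le]
        constructor <;> linarith [htp.1, htp.2]
    · have hsub : T ⊆ {j₀, j₁} := by
        intro j hj
        have := Finset.mem_Icc.1 (hTIcc hj)
        simp only [Fin.le_def] at this
        simp only [Finset.mem_insert, Finset.mem_singleton, Fin.ext_iff]
        omega
      calc _ ≤ ∑ j ∈ {j₀, j₁}, (if j = j₁ then M * v else M * u) ^ s :=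
            Finset.sum_le_sum_of_subset_of_nonneg hsub fun j _ _ => by
              split_ifs <;> positivity
        _ = (M * u) ^ s + (M * v) ^ s := by
            rw [Finset.sum_pair hlt.ne, if_neg hlt.ne, if_pos rfl]
        _ ≤ M ^ s := rpow_add_rpow_le hs0 hs1 hεs hM0 hu0.le hv0.le (by rw [hu, hv]; ring)
        _ ≤ A ^ s := hMA
  · set a : ℝ := M * (2 * ε) ^ P.card / (P.card).factorial with ha
    have ha0 : 0 ≤ a := by positivity
    refine ⟨T, fun _ => a, hTl, fun _ => ha0, hcov, ?_, ?_⟩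
    · intro j _ y hy z hz
      refine h.dist_le_of_abs_deriv_le hl (D := I ∩ Metric.ball (x : ℝ) ε)
        ((convex_Icc 0 1).inter (convex_ball _ _)) Set.inter_subset_left ?_
        ⟨y.2, hy.2⟩ ⟨z.2, hz.2⟩
      rintro t ⟨ht, htx⟩
      refine (h.abs_deriv_le_prod P hPl hP0 ht).trans ?_
      refine div_le_div_of_nonneg_right (mul_le_mul_of_nonneg_left ?_ hM0) (by positivity)
      rw [← Finset.prod_const]
      refine Finset.prod_le_prod (fun _ _ => abs_nonneg _) fun p hp => ?_
      have h1 : |t - x| < ε := htx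
      have h2 := hPx p hp
      rw [abs_lt] at h1 h2
      rw [abs_le]
      constructor <;> linarith
    · rw [Finset.sum_const, nsmul_eq_mul]
      have h1 : (T.card : ℝ) ≤ (P.card : ℝ) + 1 := by exact_mod_cast hTcard
      calc (T.card : ℝ) * a ^ s ≤ ((P.card : ℝ) + 1) * a ^ s := by gcongr
        _ ≤ M ^ s := succ_mul_rpow_le hε hs0 hs1 hεs hM0 hk
        _ ≤ A ^ s := hMA

end

end IntervalMap

end

/-! ### Choice of the exponent and conclusion -/

theorem mainTheorem4 (l : ℕ) (f : unitInterval → unitInterval)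
    (hmul : IntervalMap.IsMultimodal l f) (hreg : IntervalMap.IsCr l f)
    (ε : ℝ) (hε0 : 0 < ε) (hε1 : ε < 1) :
    TailEntropy.tailEntropy f ε ≤
      ((Real.posLog (IntervalMap.crNorm l f) / |Real.log ε| : ℝ) : EReal) := by
  obtain ⟨-, ⟨c, hc⟩, hleast⟩ := hmul
  have hleast' : ∀ k c, IntervalMap.IsMonotoneSubdivision f k c → l ≤ k :=
    fun k c hc => hleast ⟨c, hc⟩
  have hl : 1 ≤ l := by
    obtain ⟨j, -⟩ := hc.exists_mem_lap 0
    have := j.2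
    omega
  have hlog : Real.log ε < 0 := Real.log_neg hε0 hε1
  set A := max 1 (IntervalMap.crNorm l f) with hA
  have hA1 : 1 ≤ A := le_max_left _ _
  have hposLog : Real.posLog (IntervalMap.crNorm l f) = Real.log A :=
    Real.posLog_eq_log_max_one IntervalMap.crNorm_nonneg
  set s : ℝ := 1 / |Real.log ε| with hs
  have hs0 : 0 < s := by
    have : 0 < |Real.log ε| := abs_pos.2 hlog.ne
    positivity
  have hεs : ε ^ s = Real.exp (-1) := by
    rw [Real.rpow_def_of_pos hε0, hs, abs_of_neg hlog]
    congr 1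
    have := hlog.ne
    field_simp
  rw [hposLog, div_eq_mul_one_div, ← hs, mul_comm]
  refine iSup_le fun δ => ?_
  -- The concavity and power estimates need s ≤ 1; for s ≥ 1 the Lipschitz bound log A is already at
  -- most s log A.
  rcases le_total s 1 with hs1 | hs1
  · exact IntervalMap.tailEntropyAt_le_of_localExpansion hA1 hs0.le (hreg.dist_le hl) hc.2.2.2
      (hreg.hasLocalExpansion hleast' hc hε0 hs0 hs1 hεs)
      (fun τ hτ => hreg.hasSmallFolds hleast' hc hτ) δ.2
  · refine (IntervalMap.tailEntropyAt_le_log_lipschitz hA1 (hreg.dist_le hl) δ.2).trans ?_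
    exact EReal.coe_le_coe_iff.2 (le_mul_of_one_le_left (Real.log_nonneg hA1) hs1)
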